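/- Let $X$ be a normal topological space, let $Y$ be a paracompact normal topological space (for instance, any paracompact Hausdorff space), and let $r\colon X\to Y$ be a refinable map. If $X$ is $S$-weakly infinite-dimensional, then $Y$ is $S$-weakly infinite-dimensional. Here the terms are as follows. A space is normal if any two disjoint closed subsets have disjoint open neighbourhoods, and paracompact if every open cover has a locally finite open refinement (no further separation axioms are required). For an open cover $\omega$ of $X$, a continuous map $f\colon X\to Y$ is an $\omega$-map if there is an open cover $\beta$ of $Y$ such that for every $V\in\beta$ the set $f^{-1}(V)$ is contained in some element of $\omega$. A continuous surjection $r\colon X\to Y$ is refinable if for every locally finite open cover $\omega$ of $X$ and every open cover $\gamma$ of $Y$ there is a surjective $\omega$-map $f\colon X\to Y$ such that for every $x\in X$ some element of $\gamma$ contains both $r(x)$ and $f(x)$. A closed separator between $A$ and $B$ in a space $Z$ is a closed set $C\subset Z$ such that $Z\setminus C$ is the union of two disjoint open sets, one containing $A$ and the other containing $B$. A space $Z$ is $S$-weakly infinite-dimensional if for every sequence $(A_i,B_i)_{i\ge 1}$ of pairs of closed subsets of $Z$ with $A_i\cap B_i=\emptyset$ for each $i$, there are closed separators $C_i$ between $A_i$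 and $B_i$ such that $\bigcap_{i=1}^{n}C_i=\emptyset$ for some $n\ge 1$. -/

import Mathlib

/-- `ω` is an open cover of `X`. -/
def IsOpenCovering {X : Type*} [TopologicalSpace X] (ω : Set (Set X)) : Prop :=
  (∀ U ∈ ω, IsOpen U) ∧ ⋃₀ ω = Set.univ

/-- `ω` is a locally finite family of subsets of `X`. -/
def IsLocallyFiniteFamily {X : Type*} [TopologicalSpace X] (ω : Set (Set X)) : Prop :=
  LocallyFinite (fun U : ω => (U : Set X))

/-- A continuous map `f : X → Y` is an `ω`-map if there is an open cover `γ` of `Y` such that the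
family of preimages `f ⁻¹' V`, `V ∈ γ`, refines `ω`. -/
def IsCoverMap {X Y : Type*} [TopologicalSpace X] [TopologicalSpace Y]
    (ω : Set (Set X)) (f : X → Y) : Prop :=
  Continuous f ∧
    ∃ γ : Set (Set Y), IsOpenCovering γ ∧ ∀ V ∈ γ, ∃ U ∈ ω, f ⁻¹' V ⊆ U

/-- `r` and `f` are `γ`-close: for every `x` some element of `γ` contains both `r x` and `f x`. -/
def AreCoverClose {X Y : Type*} (γ : Set (Set Y)) (r f : X → Y) : Prop :=
  ∀ x, ∃ V ∈ γ, r x ∈ V ∧ f x ∈ V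

/-- A surjective continuous map `r : X → Y` is refinable if for every locally finite open cover
`ω` of `X` and every open cover `γ` of `Y` there is a surjective `ω`-map `f : X → Y` that is
`γ`-close to `r`. -/
def IsRefinable {X Y : Type*} [TopologicalSpace X] [TopologicalSpace Y] (r : X → Y) : Prop :=
  Continuous r ∧ Function.Surjective r ∧
    ∀ (ω : Set (Set X)) (γ : Set (Set Y)),
      IsOpenCovering ω → IsLocallyFiniteFamily ω → IsOpenCovering γ →
        ∃ f : X → Y, Function.Surjective f ∧ IsCoverMap ω f ∧ AreCoverClose γ r f

/-- `C` is a closed separator between `A` and `B`: a closed set whose complement is the union of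
two disjoint open sets containing `A` and `B` respectively. -/
def IsClosedSeparator {X : Type*} [TopologicalSpace X] (C A B : Set X) : Prop :=
  IsClosed C ∧
    ∃ U V : Set X, IsOpen U ∧ IsOpen V ∧ Disjoint U V ∧ A ⊆ U ∧ B ⊆ V ∧ Cᶜ = U ∪ V

/-- `X` is `S`-weakly infinite-dimensional: every sequence of pairs of disjoint closed sets admits
closed separators such that finitely many of them already have empty intersection. -/
def IsSWeaklyInfiniteDimensional (X : Type*) [TopologicalSpace X] : Prop :=
  ∀ A B : ℕ → Set X, (∀ i, IsClosed (A i)) → (∀ i, IsClosed (B i)) →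
    (∀ i, Disjoint (A i) (B i)) →
      ∃ C : ℕ → Set X, (∀ i, IsClosedSeparator (C i) (A i) (B i)) ∧
        ∃ n : ℕ, ⋂ i ≤ n, C i = ∅

/-!
Separators in `X` of the preimages of closed neighbourhoods of `A i` and `B i` have complements
`U i ∪ V i`, and finitely many of the `U i`, `V i` form an open cover `ω` of `X`. A surjective
`ω`-map `f` sufficiently close to `r` carries this cover to `Y`: replace each `U` by its open kernel
image `openKernelImage f U`, the largest open set of `Y` whose preimage lies in `U`. These sets cover
`Y` because `f` is an `ω`-map, the images of `U i` and `V i` stay disjoint because `f` is surjective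
(`disjoint_openKernelImage`), and they contain `A i` and `B i` because closeness gives
`f ⁻¹' O ⊆ r ⁻¹' P` for neighbourhoods `O` and `P` of `A i` with `closure O ⊆ P`
(`exists_openCovering_preimage_subset`). Closeness can be arranged for only finitely many indices at
once; for the other indices normality of `Y` provides separators.
-/

open Set

/-- The largest open subset of `Y` whose preimage under `f` is contained in `U`. -/
def openKernelImage {X Y : Type*} [TopologicalSpace Y] (f : X → Y) (U : Set X) : Set Y :=
  ⋃₀ {W | IsOpen W ∧ f ⁻¹' W ⊆ U}

theorem isOpen_openKernelImage {X Y : Type*} [TopologicalSpace Y] (f : X → Y) (U : Set X) :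
    IsOpen (openKernelImage f U) :=
  isOpen_sUnion fun _ hW => hW.1

theorem subset_openKernelImage {X Y : Type*} [TopologicalSpace Y] {f : X → Y} {U : Set X}
    {W : Set Y} (hW : IsOpen W) (h : f ⁻¹' W ⊆ U) : W ⊆ openKernelImage f U :=
  subset_sUnion_of_mem ⟨hW, h⟩

theorem preimage_openKernelImage_subset {X Y : Type*} [TopologicalSpace Y] (f : X → Y)
    (U : Set X) : f ⁻¹' openKernelImage f U ⊆ U := by
  rintro x ⟨W, hW, hx⟩
  exact hW.2 hx

theorem disjoint_openKernelImage {X Y : Type*} [TopologicalSpace Y] {f : X → Y}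
    (hf : Function.Surjective f) {U V : Set X} (h : Disjoint U V) :
    Disjoint (openKernelImage f U) (openKernelImage f V) :=
  Disjoint.of_preimage hf <|
    h.mono (preimage_openKernelImage_subset f U) (preimage_openKernelImage_subset f V)

/-- For finitely many closed sets `F i` inside open sets `G i`, any `f` close enough to `r`
maps into `F i` only points that `r` maps into `G i`. -/
theorem exists_openCovering_preimage_subset {ι X Y : Type*} [Finite ι] [TopologicalSpace Y]
    {F G : ι → Set Y} (hF : ∀ i, IsClosed (F i)) (hG : ∀ i, IsOpen (G i))
    (hFG : ∀ i, F i ⊆ G i) :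
    ∃ γ : Set (Set Y), IsOpenCovering γ ∧
      ∀ r f : X → Y, AreCoverClose γ r f → ∀ i, f ⁻¹' F i ⊆ r ⁻¹' G i := by
  classical
  refine ⟨{W | IsOpen W ∧ ∀ i, Disjoint W (F i) ∨ W ⊆ G i}, ⟨fun _ hW => hW.1, ?_⟩, ?_⟩
  · refine eq_univ_of_forall fun y => ⟨⋂ i, if y ∈ F i then G i else (F i)ᶜ,
      ⟨isOpen_iInter_of_finite fun i => ?_, fun i => ?_⟩, mem_iInter.2 fun i => ?_⟩
    · split_ifs
      · exact hG i
      · exact (hF i).isOpen_compl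
    · by_cases hy : y ∈ F i
      · exact Or.inr ((iInter_subset _ i).trans_eq (if_pos hy))
      · exact Or.inl (disjoint_compl_left.mono_left ((iInter_subset _ i).trans_eq (if_neg hy)))
    · split_ifs with hy
      · exact hFG i hy
      · exact hy
  · intro r f hrf i x hx
    obtain ⟨W, ⟨-, hW⟩, hr, hf⟩ := hrf x
    exact (hW i).elim (fun h => (disjoint_left.1 h hf hx).elim) fun h => h hr

theorem isClosedSeparator_compl_union {X : Type*} [TopologicalSpace X] {A B U V : Set X}
    (hU : IsOpen U) (hV : IsOpen V) (hUV : Disjoint U V) (hA : A ⊆ U) (hB : B ⊆ V) :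
    IsClosedSeparator (U ∪ V)ᶜ A B :=
  ⟨(hU.union hV).isClosed_compl, U, V, hU, hV, hUV, hA, hB, compl_compl _⟩

/-- Disjoint closed sets in a normal space have neighbourhoods `O ⊆ closure O ⊆ P` and
`R ⊆ closure R ⊆ Q` for which the closures of `P` and `Q` are still disjoint. -/
theorem exists_nested_open_nhds {Y : Type*} [TopologicalSpace Y] [NormalSpace Y] {A B : Set Y}
    (hA : IsClosed A) (hB : IsClosed B) (hAB : Disjoint A B) :
    ∃ O P R Q : Set Y, IsOpen O ∧ IsOpen P ∧ IsOpen R ∧ IsOpen Q ∧ A ⊆ O ∧ closure O ⊆ P ∧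
      B ⊆ R ∧ closure R ⊆ Q ∧ Disjoint (closure P) (closure Q) := by
  obtain ⟨P, hP, hAP, hPB⟩ :=
    normal_exists_closure_subset hA hB.isOpen_compl hAB.subset_compl_right
  obtain ⟨O, hO, hAO, hOP⟩ := normal_exists_closure_subset hA hP hAP
  obtain ⟨Q, hQ, hBQ, hQP⟩ := normal_exists_closure_subset hB
    (isClosed_closure (s := P)).isOpen_compl (subset_compl_comm.1 hPB)
  obtain ⟨R, hR, hBR, hRQ⟩ := normal_exists_closure_subset hB hQ hBQ
  exact ⟨O, P, R, Q, hO, hP, hR, hQ, hAO, hOP, hBR, hRQ,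
    (disjoint_left.2 fun _ hq hp => hQP hq hp : Disjoint (closure Q) (closure P)).symm⟩

theorem theorem4p1 {X : Type*} {Y : Type*} [TopologicalSpace X] [TopologicalSpace Y]
    [NormalSpace X] [NormalSpace Y] [ParacompactSpace Y]
    (r : X → Y) (hr : IsRefinable r) (hX : IsSWeaklyInfiniteDimensional X) :
    IsSWeaklyInfiniteDimensional Y := by
  classical
  intro A B hA hB hAB
  obtain ⟨hrc, -, hr⟩ := hr
  choose O P R Q hO hP hR hQ hAO hOP hBR hRQ hPQ using
    fun i => exists_nested_open_nhds (hA i) (hB i) (hAB i)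
  obtain ⟨C, hC, n, hn⟩ := hX (fun i => r ⁻¹' closure (P i)) (fun i => r ⁻¹' closure (Q i))
    (fun i => isClosed_closure.preimage hrc) (fun i => isClosed_closure.preimage hrc)
    (fun i => (hPQ i).preimage r)
  choose _ U V hU hV hUV hPU hQV hCUV using hC
  obtain ⟨γ, hγ, hclose⟩ := exists_openCovering_preimage_subset (X := X)
    (F := Sum.elim (fun i : Iic n => closure (O i)) fun i : Iic n => closure (R i))
    (G := Sum.elim (fun i : Iic n => P i) fun i : Iic n => Q i)
    (by rintro (i | i) <;> exact isClosed_closure)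
    (by rintro (i | i); exacts [hP i, hQ i])
    (by rintro (i | i); exacts [hOP i, hRQ i])
  let ω : Set (Set X) := U '' Iic n ∪ V '' Iic n
  have hω : IsOpenCovering ω := by
    refine ⟨?_, eq_univ_of_forall fun x => ?_⟩
    · rintro _ (⟨i, -, rfl⟩ | ⟨i, -, rfl⟩)
      exacts [hU i, hV i]
    · have hx : x ∉ ⋂ i ≤ n, C i := hn ▸ notMem_empty x
      simp only [mem_iInter, not_forall] at hx
      obtain ⟨i, hi, hx⟩ := hx
      have hx' : x ∈ U i ∪ V i := hCUV i ▸ hx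
      rcases hx' with hx' | hx'
      · exact ⟨U i, Or.inl ⟨i, hi, rfl⟩, hx'⟩
      · exact ⟨V i, Or.inr ⟨i, hi, rfl⟩, hx'⟩
  have hωfin : ω.Finite := ((finite_Iic n).image U).union ((finite_Iic n).image V)
  have hωlf : IsLocallyFiniteFamily ω := by
    have := hωfin.to_subtype
    exact locallyFinite_of_finite _
  obtain ⟨f, hfs, ⟨-, δ, hδ, hδω⟩, hrf⟩ := hr ω γ hω hωlf hγ
  have hsep : ∀ i, ∃ D, IsClosedSeparator D (A i) (B i) ∧
      (i ≤ n → D = (openKernelImage f (U i) ∪ openKernelImage f (V i))ᶜ) := by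
    intro i
    by_cases hi : i ≤ n
    · refine ⟨_, isClosedSeparator_compl_union (isOpen_openKernelImage f _)
        (isOpen_openKernelImage f _) (disjoint_openKernelImage hfs (hUV i)) ?_ ?_, fun _ => rfl⟩
      · refine (hAO i).trans (subset_openKernelImage (hO i) ?_)
        have h : f ⁻¹' closure (O i) ⊆ r ⁻¹' P i := hclose r f hrf (Sum.inl ⟨i, hi⟩)
        exact (preimage_mono subset_closure).trans
          (h.trans ((preimage_mono subset_closure).trans (hPU i)))
      · refine (hBR i).trans (subset_openKernelImage (hR i) ?_)
        have h : f ⁻¹' closure (R i) ⊆ r ⁻¹' Q i := hclose r f hrf (Sum.inr ⟨i, hi⟩)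
        exact (preimage_mono subset_closure).trans
          (h.trans ((preimage_mono subset_closure).trans (hQV i)))
    · obtain ⟨S, T, hS, hT, hAS, hBT, hST⟩ := normal_separation (hA i) (hB i) (hAB i)
      exact ⟨_, isClosedSeparator_compl_union hS hT hST hAS hBT, fun h => (hi h).elim⟩
  choose D hD hDn using hsep
  refine ⟨D, hD, n, eq_empty_of_forall_notMem fun y hy => ?_⟩
  obtain ⟨W, hW, hyW⟩ : y ∈ ⋃₀ δ := hδ.2 ▸ mem_univ y
  obtain ⟨_, ⟨i, hi, rfl⟩ | ⟨i, hi, rfl⟩, hWU⟩ := hδω W hW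
  all_goals
    have hyi := mem_iInter₂.1 hy i hi
    rw [hDn i hi] at hyi
  · exact hyi (Or.inl (subset_openKernelImage (hδ.1 W hW) hWU hyW))
  · exact hyi (Or.inr (subset_openKernelImage (hδ.1 W hW) hWU hyW))
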